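/- Let $\mathbb{R}^{3,2}$ be $\mathbb{R}^5$ with coordinates $(X,Y,Z,U,V)$ and the inner product with quadratic form $X^2+Y^2-Z^2-UV$, let $\mathrm{Ein}^{2,1}\subset\mathbb{RP}^4$ be its projectivized nullcone, and let $\mathrm{SO}(3,2)$ be the group of linear automorphisms of $\mathbb{R}^{3,2}$ of determinant $1$, acting on $\mathrm{Ein}^{2,1}$. Embed Minkowski space $\mathbb{E}^{2,1}=\mathbb{R}^3$, with $\langle v,v\rangle=x^2+y^2-z^2$, in $\mathrm{Ein}^{2,1}$ by $v=(x,y,z)\mapsto[x:y:z:\langle v,v\rangle:1]$. Let $C\subset\mathbb{E}^{2,1}$ be the positively-oriented crooked plane with vertex the origin and spine the $x$-axis, that is, $$C=\{(x,y,-y): x\ge 0\}\cup\{(0,y,z): y^2-z^2\le 0\}\cup\{(x,y,y): x\le 0\},$$ and let the crooked surface $\overline{C}$ be its closure in $\mathrm{Ein}^{2,1}$. Let $p_0=[0:0:0:0:1]$, $p_\infty=[0:0:0:1:0]$, $p_1=[0:-1:1:0:0]$, $p_2=[0:1:1:0:0]$. Let $A\cong(\mathbb{R}_{>0})^2$ be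 the subgroup of $\mathrm{SO}(3,2)$ of the positive homotheties of $\mathbb{E}^{2,1}$ centered at the origin and the positive linear hyperbolic isometries preserving the two lightlike lines $\mathbb{R}(0,-1,1)$, $\mathbb{R}(0,1,1)$: it consists of the matrices $$1\oplus\begin{bmatrix}\frac{q+q^{-1}}2&\frac{q-q^{-1}}2\\ \frac{q-q^{-1}}2&\frac{q+q^{-1}}2\end{bmatrix}\oplus\begin{bmatrix}r&0\\0&r^{-1}\end{bmatrix},\qquad r,q>0 .$$ Let $$s_0=\mathrm{diag}(1,-1,-1,1,1),\qquad s_1=-\left(I_3\oplus\begin{bmatrix}0&1\\1&0\end{bmatrix}\right),\qquad s_2=\mathrm{diag}(-1,1,-1,1,1).$$ Then $s_0,s_1,s_2$ are pairwise commuting involutions in $\mathrm{SO}(3,2)$; $A$ is a Cartan subgroup of $\mathrm{SO}(3,2)$ (that is, it is maximal among the subgroups that are simultaneously diagonalizable over $\mathbb{R}$ with positive eigenvalues); and the full stabilizer of $\overline{C}$ in $\mathrm{SO}(3,2)$ is the group generated by $A$ and $s_0,s_1,s_2$. This group is the semidirect product $G=\mathbb{Z}_2^3\ltimes(\mathbb{R}_{>0})^2$,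 with normal factor $A\cong(\mathbb{R}_{>0})^2$ and with $\mathbb{Z}_2^3$ generated by $s_0,s_1,s_2$. Moreover, every $g\in\mathrm{SO}(3,2)$ that preserves $\overline{C}$ lies in the normalizer of $A$ and preserves each of the pairs $\{p_0,p_\infty\}$ and $\{p_1,p_2\}$. -/

import Mathlib

open scoped LinearAlgebra.Projectivization Pointwise

namespace Crooked

noncomputable section

/-! ### Minkowski space `E^{2,1}` and crooked planes -/

/-- The Lorentzian inner product `I₂ ⊕ -I₁` on `ℝ^{2,1}`. -/
def mink (u v : Fin 3 → ℝ) : ℝ := u 0 * v 0 + u 1 * v 1 - u 2 * v 2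

/-- The null half-plane `W⁺(ℓ)` for the lightlike line `ℓ = p + ℝ v`: the points `p + w` of
`ℓ^⊥ = p + v^⊥` such that `det (u, v, w) > 0`, where `u` is a timelike vector with `⟨u, v⟩ < 0`
(the condition does not depend on the choice of `u`, nor on the choice of `v` directing `ℓ`). -/
def posWing (p v : Fin 3 → ℝ) : Set (Fin 3 → ℝ) :=
  {x | ∃ w, x = p + w ∧ mink v w = 0 ∧
    ∃ u, mink u u < 0 ∧ mink u v < 0 ∧ 0 < (Matrix.of ![u, v, w]).det}

/-- The stem: the points of the plane `p + span {v₁, v₂}` in the causal future or past of `p`. -/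
def stem (p v₁ v₂ : Fin 3 → ℝ) : Set (Fin 3 → ℝ) :=
  {x | ∃ w ∈ Submodule.span ℝ {v₁, v₂}, x = p + w ∧ mink w w ≤ 0}

/-- The positively-oriented crooked plane with vertex `p` whose stem is bounded by the
lightlike lines `p + ℝ v₁` and `p + ℝ v₂`. -/
def posCrookedPlane (p v₁ v₂ : Fin 3 → ℝ) : Set (Fin 3 → ℝ) :=
  posWing p v₁ ∪ stem p v₁ v₂ ∪ posWing p v₂

/-- The positively-oriented crooked plane with vertex the origin and spine the `x`-axis. -/
def crookedPlane : Set (Fin 3 → ℝ) := posCrookedPlane 0 ![0, -1, 1] ![0, 1, 1]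

/-- The explicit description of `crookedPlane`. -/
theorem mem_crookedPlane (x : Fin 3 → ℝ) :
    x ∈ crookedPlane ↔
      (x 2 = - x 1 ∧ 0 < x 0) ∨ (x 0 = 0 ∧ x 1 ^ 2 - x 2 ^ 2 ≤ 0) ∨ (x 2 = x 1 ∧ x 0 < 0) := by
  have h1 : x ∈ posWing 0 ![0, -1, 1] ↔ (x 2 = - x 1 ∧ 0 < x 0) := by
    simp only [posWing, mink, Set.mem_ofPred_eq, zero_add, exists_eq_left', Matrix.det_fin_three]
    simp
    constructor
    · rintro ⟨h, u, h2, h3, h4⟩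
      have hx : x 2 = - x 1 := by linarith
      refine ⟨hx, ?_⟩
      rw [hx] at h4
      have : 0 < (u 1 + u 2) * x 0 := by nlinarith
      exact (pos_iff_pos_of_mul_pos this).1 (by linarith)
    · rintro ⟨h, h2⟩
      refine ⟨by linarith, ![0, 0, 1], ?_⟩
      simp [h2]
  have h2 : x ∈ posWing 0 ![0, 1, 1] ↔ (x 2 = x 1 ∧ x 0 < 0) := by
    simp only [posWing, mink, Set.mem_ofPred_eq, zero_add, exists_eq_left', Matrix.det_fin_three]
    simp
    constructor
    · rintro ⟨h, u, h2, h3, h4⟩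
      have hx : x 2 = x 1 := by linarith
      refine ⟨hx, ?_⟩
      rw [hx] at h4
      have : 0 < (u 2 - u 1) * (- x 0) := by nlinarith
      have := (pos_iff_pos_of_mul_pos this).1 (by linarith)
      linarith
    · rintro ⟨h, h2⟩
      refine ⟨by linarith, ![0, 0, 1], ?_⟩
      simp [h2]
  have h3 : x ∈ stem 0 ![0, -1, 1] ![0, 1, 1] ↔ (x 0 = 0 ∧ x 1 ^ 2 - x 2 ^ 2 ≤ 0) := by
    simp only [stem, Set.mem_ofPred_eq, zero_add, Submodule.mem_span_pair]
    constructor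
    · rintro ⟨w, ⟨a, b, rfl⟩, rfl, h⟩
      simp [mink] at h ⊢
      nlinarith
    · rintro ⟨h, h'⟩
      refine ⟨x, ⟨(x 2 - x 1) / 2, (x 2 + x 1) / 2, ?_⟩, rfl, ?_⟩
      · ext i
        fin_cases i <;> simp [h] <;> ring
      · simp only [mink, h]
        nlinarith
  simp only [crookedPlane, posCrookedPlane, Set.mem_union, h1, h2, h3, or_assoc]

/-! ### The Einstein universe `Ein^{2,1}` -/

/-- The inner product of type `(3, 2)` on `ℝ^{3,2}`, given by the matrix
`I₂ ⊕ -I₁ ⊕ (-1/2) [[0, 1], [1, 0]]`. -/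
def ip (u v : Fin 5 → ℝ) : ℝ :=
  u 0 * v 0 + u 1 * v 1 - u 2 * v 2 - 1 / 2 * (u 3 * v 4) - 1 / 2 * (u 4 * v 3)

theorem ip_smul (a : ℝ) (v : Fin 5 → ℝ) : ip (a • v) (a • v) = a ^ 2 * ip v v := by
  simp only [ip, Pi.smul_apply, smul_eq_mul]; ring

/-- Real projective 4-space carries the quotient topology. -/
instance : TopologicalSpace (ℙ ℝ (Fin 5 → ℝ)) :=
  inferInstanceAs (TopologicalSpace (Quotient (projectivizationSetoid ℝ (Fin 5 → ℝ))))

/-- The Einstein universe: the projectivized nullcone of `ℝ^{3,2}`. -/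
def Ein21 : Type := {x : ℙ ℝ (Fin 5 → ℝ) // ip x.rep x.rep = 0}

instance : TopologicalSpace Ein21 :=
  inferInstanceAs (TopologicalSpace {x : ℙ ℝ (Fin 5 → ℝ) // ip x.rep x.rep = 0})

theorem ip_rep_mk {v : Fin 5 → ℝ} (h : v ≠ 0) :
    ip (Projectivization.mk ℝ v h).rep (Projectivization.mk ℝ v h).rep = 0 ↔ ip v v = 0 := by
  obtain ⟨a, ha⟩ := Projectivization.exists_smul_eq_mk_rep ℝ v h
  rw [← ha, Units.smul_def, ip_smul]
  simp

/-- The point of `Ein^{2,1}` with homogeneous coordinates `v`. -/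
def Ein21.mk (v : Fin 5 → ℝ) (h : v ≠ 0) (hv : ip v v = 0) : Ein21 :=
  ⟨Projectivization.mk ℝ v h, (ip_rep_mk h).2 hv⟩

/-- The conformal embedding `x ↦ [x : ⟨x, x⟩ : 1]` of Minkowski space in `Ein^{2,1}`. -/
def emb (x : Fin 3 → ℝ) : Ein21 :=
  Ein21.mk ![x 0, x 1, x 2, mink x x, 1] (fun h => by simpa using congrFun h 4)
    (by simp [ip, mink]; ring)

/-- The crooked surface: the closure in `Ein^{2,1}` of the crooked plane. -/
def crookedSurface : Set Ein21 := closure (emb '' crookedPlane)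

/-- The vertex `p₀`, that is, the origin of Minkowski space. -/
def p₀ : Ein21 := Ein21.mk ![0, 0, 0, 0, 1] (fun h => by simpa using congrFun h 4) (by simp [ip])

/-- The improper point. -/
def pInf : Ein21 := Ein21.mk ![0, 0, 0, 1, 0] (fun h => by simpa using congrFun h 3) (by simp [ip])

/-- The ideal point of the lightlike line through `(0, -1, 1)`. -/
def p₁ : Ein21 := Ein21.mk ![0, -1, 1, 0, 0] (fun h => by simpa using congrFun h 2) (by simp [ip])

/-- The ideal point of the lightlike line through `(0, 1, 1)`. -/
def p₂ : Ein21 := Ein21.mk ![0, 1, 1, 0, 0] (fun h => by simpa using congrFun h 2) (by simp [ip])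

/-! ### The group `SO(3,2)` and its action on `Ein^{2,1}` -/

/-- `SO(3,2)`: the matrices of determinant `1` that preserve the inner product. -/
def SO32 : Subgroup (Matrix.SpecialLinearGroup (Fin 5) ℝ) where
  carrier := {g | ∀ u v : Fin 5 → ℝ, ip (g • u) (g • v) = ip u v}
  one_mem' := fun u v => by simp
  mul_mem' := fun {g h} hg hh u v => by rw [mul_smul, mul_smul, hg, hh]
  inv_mem' := fun {g} hg u v => by
    rw [← hg, smul_inv_smul, smul_inv_smul]

instance : MulAction SO32 Ein21 where
  smul g x := ⟨g.1 • x.1, by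
    obtain ⟨x, hx⟩ := x
    induction x using Projectivization.ind with
    | h v hv =>
      change ip (g.1 • Projectivization.mk ℝ v hv).rep (g.1 • Projectivization.mk ℝ v hv).rep = 0
      rw [Projectivization.smul_mk, ip_rep_mk, g.2, ← ip_rep_mk hv]
      exact hx⟩
  one_smul x := Subtype.ext (one_smul _ x.1)
  mul_smul g h x := Subtype.ext (mul_smul g.1 h.1 x.1)

theorem smul_mk (g : SO32) (v : Fin 5 → ℝ) (h : v ≠ 0) (hv : ip v v = 0) :
    g • Ein21.mk v h hv = Ein21.mk (g.1.1.mulVec v)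
      ((smul_ne_zero_iff_ne g.1).2 h) ((g.2 v v).trans hv) := rfl

/-- An element of `SO(3,2)` from a matrix. -/
def toSO (M : Matrix (Fin 5) (Fin 5) ℝ) (h : M.det = 1)
    (hM : ∀ u v, ip (M.mulVec u) (M.mulVec v) = ip u v) : SO32 := ⟨⟨M, h⟩, hM⟩

/-! ### The Cartan subgroup `A` -/

/-- The multiplicative group of positive real numbers. -/
abbrev PosReal : Type := {x : ℝ // 0 < x}

/-- The matrix of the positive homothety of ratio `r` composed with the positive hyperbolic isometry
`y ↦ (q + q⁻¹)/2 y + (q - q⁻¹)/2 z`, `z ↦ (q - q⁻¹)/2 y + (q + q⁻¹)/2 z`. -/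
def cartanMatrix (r q : ℝ) : Matrix (Fin 5) (Fin 5) ℝ :=
  !![1, 0, 0, 0, 0;
     0, (q + q⁻¹) / 2, (q - q⁻¹) / 2, 0, 0;
     0, (q - q⁻¹) / 2, (q + q⁻¹) / 2, 0, 0;
     0, 0, 0, r, 0;
     0, 0, 0, 0, r⁻¹]

/-- The parametrization of the Cartan subgroup `A` by `(ℝ_{>0})²`. -/
def cartanHom : PosReal × PosReal →* SO32 where
  toFun a := toSO (cartanMatrix a.1 a.2)
    (by
      have h1 := a.1.2.ne'
      have h2 := a.2.2.ne'
      simp [cartanMatrix, Matrix.det_succ_row_zero, Fin.sum_univ_succ, Fin.succAbove]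
      field_simp
      ring)
    (fun u v => by
      have h1 := a.1.2.ne'
      have h2 := a.2.2.ne'
      simp [cartanMatrix, ip, Matrix.mulVec, dotProduct, Fin.sum_univ_succ]
      field_simp
      ring)
  map_one' := by
    apply Subtype.ext; apply Subtype.ext
    change cartanMatrix 1 1 = 1
    ext i j
    fin_cases i <;> fin_cases j <;> simp [cartanMatrix]
  map_mul' a b := by
    have h1 := a.1.2.ne'
    have h2 := a.2.2.ne'
    have h3 := b.1.2.ne'
    have h4 := b.2.2.ne'
    apply Subtype.ext; apply Subtype.ext
    change cartanMatrix (a.1 * b.1) (a.2 * b.2) = cartanMatrix a.1 a.2 * cartanMatrix b.1 b.2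
    ext i j
    fin_cases i <;> fin_cases j <;>
      simp [cartanMatrix, Matrix.mul_apply, Fin.sum_univ_succ] <;> field_simp <;> ring

/-- The subgroup `A` of positive homotheties (centered at the origin) and positive linear hyperbolic
isometries preserving the two lightlike lines that bound the stem. -/
def cartanA : Subgroup SO32 := cartanHom.range

/-- The linear hyperbolic isometry of Minkowski space with eigenvalues `1, q, q⁻¹`. -/
def hypIsom (q : ℝ) (x : Fin 3 → ℝ) : Fin 3 → ℝ :=
  ![x 0, (q + q⁻¹) / 2 * x 1 + (q - q⁻¹) / 2 * x 2, (q - q⁻¹) / 2 * x 1 + (q + q⁻¹) / 2 * x 2]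

/-- The action of `A` on Minkowski space. -/
theorem cartanHom_smul_emb (r q : PosReal) (x : Fin 3 → ℝ) :
    cartanHom (r, q) • emb x = emb ((r : ℝ) • hypIsom q x) := by
  have h1 := r.2.ne'
  have h2 := q.2.ne'
  apply Subtype.ext
  refine (Projectivization.mk_eq_mk_iff' ℝ _ _ _ _).2 ⟨(r : ℝ)⁻¹, ?_⟩
  change (r : ℝ)⁻¹ • _ = (cartanMatrix r q).mulVec _
  ext i
  fin_cases i <;>
    simp [cartanMatrix, hypIsom, mink, Matrix.mulVec, dotProduct, Fin.sum_univ_succ] <;>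
    field_simp <;> ring

/-- A subgroup of `SO(3,2)` that is simultaneously diagonalizable over `ℝ` with positive
eigenvalues. -/
def IsPosDiagonalizable (B : Subgroup SO32) : Prop :=
  ∃ P : GL (Fin 5) ℝ, ∀ g ∈ B, ∃ d : Fin 5 → ℝ, (∀ i, 0 < d i) ∧
    (g.1.1 : Matrix (Fin 5) (Fin 5) ℝ) * P.1 = P.1 * Matrix.diagonal d

/-- A Cartan subgroup (in the sense of the `KAK` decomposition: the exponential of a maximal
abelian subalgebra of real-diagonalizable elements), that is, a maximal subgroup among those that
are simultaneously diagonalizable with positive eigenvalues. -/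
def IsCartanSubgroup (B : Subgroup SO32) : Prop := Maximal IsPosDiagonalizable B

/-! ### The involutions -/

/-- The reflection in the spine, `diag (1, -1, -1, 1, 1)`. -/
def s₀ : SO32 := toSO
  !![1, 0, 0, 0, 0; 0, -1, 0, 0, 0; 0, 0, -1, 0, 0; 0, 0, 0, 1, 0; 0, 0, 0, 0, 1]
  (by simp [Matrix.det_succ_row_zero, Fin.sum_univ_succ, Fin.succAbove])
  (fun u v => by simp [ip, Matrix.mulVec, dotProduct, Fin.sum_univ_succ])

/-- The element `-ι` of `SO(3,2)` that acts on `Ein^{2,1}` as the Lorentzian inversion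
`ι = I₃ ⊕ [[0, 1], [1, 0]]` in the unit sphere. -/
def s₁ : SO32 := toSO
  !![-1, 0, 0, 0, 0; 0, -1, 0, 0, 0; 0, 0, -1, 0, 0; 0, 0, 0, 0, -1; 0, 0, 0, -1, 0]
  (by simp [Matrix.det_succ_row_zero, Fin.sum_univ_succ, Fin.succAbove])
  (fun u v => by simp [ip, Matrix.mulVec, dotProduct, Fin.sum_univ_succ]; ring)

/-- The involution `diag (-1, 1, -1, 1, 1)`, which exchanges `p₁` and `p₂`. -/
def s₂ : SO32 := toSO
  !![-1, 0, 0, 0, 0; 0, 1, 0, 0, 0; 0, 0, -1, 0, 0; 0, 0, 0, 1, 0; 0, 0, 0, 0, 1]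
  (by simp [Matrix.det_succ_row_zero, Fin.sum_univ_succ, Fin.succAbove])
  (fun u v => by simp [ip, Matrix.mulVec, dotProduct, Fin.sum_univ_succ])

/-- The group `ℤ₂³`, written multiplicatively. -/
abbrev Z2Cubed : Type := Fin 3 → Multiplicative (ZMod 2)

/-- The `i`-th standard generator of `ℤ₂³`. -/
def z2gen (i : Fin 3) : Z2Cubed := Pi.mulSingle i (Multiplicative.ofAdd 1)

end

end Crooked

open Crooked

/-!
The crooked surface is the projectivized set of null vectors of an explicit closed cone
(`mk_mem_crookedSurface`): two wings and a stem, lying in the hyperplanes `Y + Z = 0`, `Y = Z` and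
`X = 0`. The points at infinity of the cone are limits of points of the crooked plane along explicit
curves. This description shows at once that `A`, `s₀`, `s₁`, `s₂` preserve the surface.

Conversely, each of the three pieces contains a curve `t ↦ [c(t)]` with `c` a cubic polynomial
whose coefficients span the hyperplane of that piece. If `g` preserves the surface, then the images
of these points lie in the union of the three hyperplanes, and since a product of polynomials in one
variable vanishes only if a factor does, `g` maps each of the hyperplanes to one of the three
(`exists_mulVec_wallNormal`). Dually, `g` permutes the lines spanned by their normals, one spacelike
(the spine) and two null and not orthogonal (`p₁` and `p₂`). So `g` fixes the first line, and
preserves the pair of the other two; hence it preserves the orthogonal complement of all three,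
a Lorentzian plane whose null lines are `p₀` and `pInf`. After multiplication by some of `s₂`,
`s₁`, `s₀`, the map `g` is diagonal in the basis of these five vectors, with positive eigenvalues
on `p₁` and `p₂`; the determinant gives eigenvalue `1` on the spine, and a point of one wing shows that the
other two eigenvalues are positive, so `g ∈ A` (`mem_cartanA_of_diagonal`).

The same diagonal basis shows that `A` is a Cartan subgroup: a simultaneously diagonalizable group
containing `A` commutes with an element of `A` with simple spectrum. The remaining claims follow by
checking the generators: conjugation by `s₁` and `s₂` inverts one of the two coordinates of `A`, and
a nontrivial product of the involutions is not in `A` because it exchanges `p₀` and `pInf`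
or has a negative eigenvalue.
-/

open scoped LinearAlgebra.Projectivization Pointwise

namespace Crooked

/-! ### The cone over the crooked surface -/

/-- The cone in `ℝ^{3,2}` whose null vectors lie over the crooked surface. Its three pieces
(wing, stem, wing) lie in the hyperplanes `Y + Z = 0`, `X = 0` and `Y = Z`. -/
def crookedCone : Set (Fin 5 → ℝ) :=
  {v | (v 1 + v 2 = 0 ∧ 0 ≤ v 0 * v 3 ∧ 0 ≤ v 0 * v 4) ∨ (v 0 = 0 ∧ v 3 * v 4 ≤ 0) ∨
    (v 1 = v 2 ∧ v 0 * v 3 ≤ 0 ∧ v 0 * v 4 ≤ 0)}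

theorem smul_mem_crookedCone {c : ℝ} (hc : c ≠ 0) (v : Fin 5 → ℝ) :
    c • v ∈ crookedCone ↔ v ∈ crookedCone := by
  have h2 : 0 < c ^ 2 := by positivity
  have e1 : ∀ x y, c * x * (c * y) = c ^ 2 * (x * y) := fun x y => by ring
  have e3 : c * v 1 + c * v 2 = c * (v 1 + v 2) := by ring
  have e4 : ∀ y, c ^ 2 * y ≤ 0 ↔ y ≤ 0 := fun y => by
    rw [← not_lt, ← not_lt, mul_pos_iff_of_pos_left h2]
  rw [crookedCone, Set.mem_ofPred_eq, Set.mem_ofPred_eq]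
  simp only [Pi.smul_apply, smul_eq_mul]
  simp only [e1, e3, e4, mul_nonneg_iff_of_pos_left h2, mul_eq_zero_iff_left hc,
    mul_right_inj' hc]

theorem isClosed_crookedCone : IsClosed crookedCone := by
  have h (i : Fin 5) : Continuous fun v : Fin 5 → ℝ => v i := continuous_apply i
  have hp (i j : Fin 5) : Continuous fun v : Fin 5 → ℝ => v i * v j := (h i).mul (h j)
  exact ((isClosed_eq ((h 1).add (h 2)) continuous_const).inter
    ((isClosed_le continuous_const (hp 0 3)).inter (isClosed_le continuous_const (hp 0 4)))).union
    (((isClosed_eq (h 0) continuous_const).inter (isClosed_le (hp 3 4) continuous_const)).union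
    ((isClosed_eq (h 1) (h 2)).inter
    ((isClosed_le (hp 0 3) continuous_const).inter (isClosed_le (hp 0 4) continuous_const))))

theorem rep_mk_mem_crookedCone {v : Fin 5 → ℝ} (h : v ≠ 0) :
    (Projectivization.mk ℝ v h).rep ∈ crookedCone ↔ v ∈ crookedCone := by
  obtain ⟨a, ha⟩ := Projectivization.exists_smul_eq_mk_rep ℝ v h
  rw [← ha, Units.smul_def, smul_mem_crookedCone a.ne_zero]

theorem Ein21.ind {p : Ein21 → Prop} (h : ∀ v hv hn, p (Ein21.mk v hv hn)) (x : Ein21) : p x := by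
  obtain ⟨x, hx⟩ := x
  induction x using Projectivization.ind with
  | h v hv => exact h v hv ((ip_rep_mk hv).1 hx)

theorem Ein21.mk_eq_mk_of_smul {v w : Fin 5 → ℝ} {hv hn hw hm} (c : ℝ) (h : c • w = v) :
    Ein21.mk v hv hn = Ein21.mk w hw hm :=
  Subtype.ext ((Projectivization.mk_eq_mk_iff' ℝ _ _ _ _).2 ⟨c, h⟩)

theorem isClosed_rep_mem_crookedCone : IsClosed {x : Ein21 | x.1.rep ∈ crookedCone} := by
  have h : IsClosed {x : ℙ ℝ (Fin 5 → ℝ) | x.rep ∈ crookedCone} := by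
    refine (isQuotientMap_quotient_mk'
      (s := projectivizationSetoid ℝ (Fin 5 → ℝ))).isClosed_preimage.1 ?_
    convert isClosed_crookedCone.preimage (continuous_subtype_val (p := fun v : Fin 5 → ℝ => v ≠ 0))
      using 1
    ext v
    exact rep_mk_mem_crookedCone v.2
  exact h.preimage continuous_subtype_val

/-- Null vectors of the cone with `V ≠ 0` project into Minkowski space, to the crooked plane. -/
theorem mk_mem_emb_of_ne {v : Fin 5 → ℝ} (h hn) (hv : v ∈ crookedCone) (h4 : v 4 ≠ 0) :
    Ein21.mk v h hn ∈ emb '' crookedPlane := by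
  have hn' := hn
  simp only [ip] at hn'
  refine ⟨![v 0 / v 4, v 1 / v 4, v 2 / v 4], ?_, ?_⟩
  · rw [mem_crookedPlane]
    have hp : 0 < v 4 ^ 2 := by positivity
    have key : ∀ s : ℝ, 0 ≤ s * (v 0 * v 4) → 0 ≤ s * (v 0 / v 4) := by
      intro s h1
      have e : s * (v 0 / v 4) = s * (v 0 * v 4) / v 4 ^ 2 := by field_simp
      rw [e]
      exact div_nonneg h1 hp.le
    have hstem : v 1 ^ 2 - v 2 ^ 2 ≤ 0 → (v 1 / v 4) ^ 2 - (v 2 / v 4) ^ 2 ≤ 0 := by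
      intro h1
      rw [div_pow, div_pow, ← sub_div]
      exact div_nonpos_of_nonpos_of_nonneg h1 hp.le
    simp only [Matrix.cons_val]
    rcases hv with ⟨h1, -, h2⟩ | ⟨h1, h2⟩ | ⟨h1, -, h2⟩
    · have e : v 2 = - v 1 := by linarith
      have := key 1 (by linarith)
      rcases this.lt_or_eq with h | h
      · exact Or.inl ⟨by rw [e]; ring, by linarith⟩
      · exact Or.inr (Or.inl ⟨by linarith, hstem (by rw [e]; linarith)⟩)
    · refine Or.inr (Or.inl ⟨by rw [h1, zero_div], hstem ?_⟩)
      rw [h1] at hn'; linarith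
    · have := key (-1) (by linarith)
      rcases this.lt_or_eq with h | h
      · exact Or.inr (Or.inr ⟨by rw [h1], by linarith⟩)
      · exact Or.inr (Or.inl ⟨by linarith, hstem (by rw [h1]; linarith)⟩)
  · refine Ein21.mk_eq_mk_of_smul (v 4)⁻¹ ?_
    ext i
    fin_cases i <;> simp [mink] <;> field_simp
    linarith

theorem continuous_ein_mk {T : Type*} [TopologicalSpace T] (c : T → Fin 5 → ℝ) (hc : Continuous c)
    (h0 : ∀ t, c t ≠ 0) (hn : ∀ t, ip (c t) (c t) = 0) :
    Continuous fun t => Ein21.mk (c t) (h0 t) (hn t) := by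
  refine Continuous.subtype_mk ?_ _
  have h : Continuous fun t => (⟨c t, h0 t⟩ : {v : Fin 5 → ℝ // v ≠ 0}) := hc.subtype_mk _
  exact (continuous_quotient_mk' (s := projectivizationSetoid ℝ (Fin 5 → ℝ))).comp h

/-- A point is in the crooked surface if a curve of null vectors in the cone that leaves the
hyperplane `V = 0` for positive time starts at it. -/
theorem mk_mem_crookedSurface_of_curve (c : ℝ → Fin 5 → ℝ) (hc : Continuous c)
    (h0 : ∀ t, c t ≠ 0) (hn : ∀ t, ip (c t) (c t) = 0)
    (hK : ∀ t > 0, c t ∈ crookedCone ∧ c t 4 ≠ 0) :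
    Ein21.mk (c 0) (h0 0) (hn 0) ∈ crookedSurface := by
  have hlim := ((continuous_ein_mk c hc h0 hn).tendsto 0).mono_left
    (nhdsWithin_le_nhds (s := Set.Ioi 0))
  refine mem_closure_of_tendsto hlim ?_
  filter_upwards [self_mem_nhdsWithin] with t ht
  exact mk_mem_emb_of_ne _ _ (hK t ht).1 (hK t ht).2

theorem mk_mem_crookedSurface {v : Fin 5 → ℝ} (h hn) :
    Ein21.mk v h hn ∈ crookedSurface ↔ v ∈ crookedCone := by
  constructor
  · intro hv
    refine (rep_mk_mem_crookedCone h).1 (closure_minimal ?_ isClosed_rep_mem_crookedCone hv)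
    rintro _ ⟨x, hx, rfl⟩
    refine (rep_mk_mem_crookedCone _).2 ?_
    rw [mem_crookedPlane] at hx
    simp only [crookedCone, mink, Set.mem_ofPred_eq, Matrix.cons_val]
    rcases hx with ⟨h1, h2⟩ | ⟨h1, h2⟩ | ⟨h1, h2⟩
    · refine Or.inl ⟨by linarith, ?_, by linarith⟩
      rw [h1]; nlinarith [mul_nonneg h2.le (sq_nonneg (x 0))]
    · refine Or.inr (Or.inl ⟨h1, ?_⟩)
      rw [h1]; linarith
    · refine Or.inr (Or.inr ⟨h1.symm, ?_, by linarith⟩)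
      rw [h1]; nlinarith [mul_nonneg (neg_nonneg.2 h2.le) (sq_nonneg (x 0))]
  · intro hv
    by_cases h4 : v 4 = 0
    swap
    · exact subset_closure (mk_mem_emb_of_ne h hn hv h4)
    -- a point at infinity has `X = 0` and `Y = ± Z`
    have hq := hn
    simp only [ip, h4] at hq
    have h00 : v 0 = 0 ∧ (v 1 + v 2) * (v 1 - v 2) = 0 := by
      rcases hv with ⟨h1, -⟩ | ⟨h1, -⟩ | ⟨h1, -⟩
      · have e : v 2 = - v 1 := by linarith
        exact ⟨by rw [e] at hq; nlinarith, by rw [h1]; ring⟩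
      · exact ⟨h1, by rw [h1] at hq; linarith⟩
      · exact ⟨by rw [h1] at hq; nlinarith, by rw [h1]; ring⟩
    -- it is approached along the wing or, when `U = 0` too, along a lightlike line
    have hs : ∃ s : ℝ, s * s = 1 ∧ v 1 = - s * v 2 := by
      rcases mul_eq_zero.1 h00.2 with h1 | h1
      · exact ⟨1, by norm_num, by linarith⟩
      · exact ⟨-1, by norm_num, by linarith⟩
    obtain ⟨s, hss, hs⟩ := hs
    have hcone : ∀ w : Fin 5 → ℝ, w 1 = v 1 → w 2 = v 2 → 0 ≤ s * (w 0 * w 3) →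
        0 ≤ s * (w 0 * w 4) → w ∈ crookedCone := by
      intro w h1 h2 h3 h4
      rcases mul_self_eq_one_iff.1 hss with rfl | rfl
      · exact Or.inl ⟨by rw [h1, h2]; linarith, by linarith, by linarith⟩
      · exact Or.inr (Or.inr ⟨by rw [h1, h2]; linarith, by linarith, by linarith⟩)
    have hv12 : v 1 * v 1 = v 2 * v 2 := by
      rw [hs]; linear_combination v 2 * v 2 * hss
    have hne : ∀ (f : Fin 5 → ℝ), f 1 = v 1 → f 2 = v 2 → f 3 = v 3 → f ≠ 0 := by
      intro f h1 h2 h3 hf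
      refine h ?_
      rw [hf] at h1 h2 h3
      ext i
      fin_cases i
      · exact h00.1
      · exact h1.symm
      · exact h2.symm
      · exact h3.symm
      · exact h4
    by_cases h3 : v 3 = 0
    · have := mk_mem_crookedSurface_of_curve (fun t => ![0, v 1, v 2, v 3, t])
        (by fun_prop) (fun t => hne _ rfl rfl rfl)
        (fun t => by simp only [ip, Matrix.cons_val]; rw [h3]; linarith)
        (fun t ht => ⟨hcone _ rfl rfl (by simp) (by simp), ht.ne'⟩)
      convert this using 2
      ext i; fin_cases i <;> simp [h00.1, h4]
    · have := mk_mem_crookedSurface_of_curve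
        (fun t => ![s * t * v 3, v 1, v 2, v 3, t ^ 2 * v 3])
        (by fun_prop) (fun t => hne _ rfl rfl rfl)
        (fun t => by
          simp only [ip, Matrix.cons_val]
          linear_combination (t ^ 2 * v 3 ^ 2) * hss + hv12)
        (fun t ht => by
          have ht' : 0 < t := ht
          refine ⟨hcone _ rfl rfl ?_ ?_, mul_ne_zero (pow_ne_zero 2 ht'.ne') h3⟩ <;>
            simp only [Matrix.cons_val]
          · have : s * (s * t * v 3 * v 3) = t * v 3 ^ 2 := by
              linear_combination (t * v 3 ^ 2) * hss
            rw [this]; positivity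
          · have : s * (s * t * v 3 * (t ^ 2 * v 3)) = t ^ 3 * v 3 ^ 2 := by
              linear_combination (t ^ 3 * v 3 ^ 2) * hss
            rw [this]; positivity)
      convert this using 2
      ext i; fin_cases i <;> simp [h00.1, h4]

/-! ### Stabilizer of the crooked surface in terms of the cone -/

theorem mem_crookedCone_smul_iff {g : SO32} (hg : g ∈ MulAction.stabilizer SO32 crookedSurface)
    {v : Fin 5 → ℝ} (h : v ≠ 0) (hn : ip v v = 0) :
    g.1.1.mulVec v ∈ crookedCone ↔ v ∈ crookedCone := by
  have := MulAction.mem_stabilizer_set.1 hg (Ein21.mk v h hn)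
  rwa [smul_mk, mk_mem_crookedSurface, mk_mem_crookedSurface] at this

theorem mem_stabilizer_of_cone {g : SO32}
    (hg : ∀ v, v ∈ crookedCone ↔ g.1.1.mulVec v ∈ crookedCone) :
    g ∈ MulAction.stabilizer SO32 crookedSurface := by
  rw [MulAction.mem_stabilizer_set]
  intro x
  induction x using Ein21.ind with
  | h v h hn => rw [smul_mk, mk_mem_crookedSurface, mk_mem_crookedSurface, ← hg]

theorem cartanHom_mulVec (r q : PosReal) (v : Fin 5 → ℝ) :
    (cartanHom (r, q)).1.1.mulVec v =
      ![v 0, ((q : ℝ) + (q : ℝ)⁻¹) / 2 * v 1 + ((q : ℝ) - (q : ℝ)⁻¹) / 2 * v 2,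
        ((q : ℝ) - (q : ℝ)⁻¹) / 2 * v 1 + ((q : ℝ) + (q : ℝ)⁻¹) / 2 * v 2,
        r * v 3, (r : ℝ)⁻¹ * v 4] := by
  change (cartanMatrix r q).mulVec v = _
  ext i
  fin_cases i <;> simp [cartanMatrix, Matrix.mulVec, dotProduct, Fin.sum_univ_succ]

theorem s₀_mulVec (v : Fin 5 → ℝ) : s₀.1.1.mulVec v = ![v 0, -v 1, -v 2, v 3, v 4] := by
  ext i
  fin_cases i <;> simp [s₀, toSO, dotProduct, Fin.sum_univ_succ]

theorem s₁_mulVec (v : Fin 5 → ℝ) : s₁.1.1.mulVec v = ![-v 0, -v 1, -v 2, -v 4, -v 3] := by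
  ext i
  fin_cases i <;> simp [s₁, toSO, dotProduct, Fin.sum_univ_succ]

theorem s₂_mulVec (v : Fin 5 → ℝ) : s₂.1.1.mulVec v = ![-v 0, v 1, -v 2, v 3, v 4] := by
  ext i
  fin_cases i <;> simp [s₂, toSO, dotProduct, Fin.sum_univ_succ]

theorem cartanHom_mem_stabilizer (a : PosReal × PosReal) :
    cartanHom a ∈ MulAction.stabilizer SO32 crookedSurface := by
  obtain ⟨⟨r, hr⟩, ⟨q, hq⟩⟩ := a
  have hr' := inv_pos.2 hr
  have hq' := inv_pos.2 hq
  refine mem_stabilizer_of_cone fun v => ?_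
  have e1 : (q + q⁻¹) / 2 * v 1 + (q - q⁻¹) / 2 * v 2 +
      ((q - q⁻¹) / 2 * v 1 + (q + q⁻¹) / 2 * v 2) = q * (v 1 + v 2) := by ring
  have e2 : (q + q⁻¹) / 2 * v 1 + (q - q⁻¹) / 2 * v 2 =
      (q - q⁻¹) / 2 * v 1 + (q + q⁻¹) / 2 * v 2 ↔ v 1 = v 2 := by
    rw [← sub_eq_zero, ← sub_eq_zero (a := v 1), ← mul_eq_zero_iff_left (b := v 1 - v 2) hq'.ne']
    ring_nf
  have e3 : r * v 3 * (r⁻¹ * v 4) = v 3 * v 4 := by field_simp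
  have e4 : ∀ c > 0, ∀ y, v 0 * (c * y) ≤ 0 ↔ v 0 * y ≤ 0 := fun c hc y => by
    rw [← not_lt, ← not_lt, mul_left_comm, mul_pos_iff_of_pos_left hc]
  have e5 : ∀ c > 0, ∀ y, 0 ≤ v 0 * (c * y) ↔ 0 ≤ v 0 * y := fun c hc y => by
    rw [mul_left_comm, mul_nonneg_iff_of_pos_left hc]
  rw [cartanHom_mulVec, crookedCone, Set.mem_ofPred_eq, Set.mem_ofPred_eq]
  simp only [Matrix.cons_val]
  rw [e1, e2, e3, e4 r hr, e4 _ hr', e5 r hr, e5 _ hr', mul_eq_zero_iff_left hq.ne']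

theorem s₀_mem_stabilizer : s₀ ∈ MulAction.stabilizer SO32 crookedSurface := by
  refine mem_stabilizer_of_cone fun v => ?_
  rw [s₀_mulVec]
  simp [crookedCone]
  grind

theorem s₁_mem_stabilizer : s₁ ∈ MulAction.stabilizer SO32 crookedSurface := by
  refine mem_stabilizer_of_cone fun v => ?_
  rw [s₁_mulVec]
  simp [crookedCone]
  grind

theorem s₂_mem_stabilizer : s₂ ∈ MulAction.stabilizer SO32 crookedSurface := by
  refine mem_stabilizer_of_cone fun v => ?_
  rw [s₂_mulVec]
  simp [crookedCone]
  grind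

theorem ip_mulVec (g : SO32) (u v : Fin 5 → ℝ) :
    ip (g.1.1.mulVec u) (g.1.1.mulVec v) = ip u v := g.2 u v

theorem inv_mulVec_mulVec (g : SO32) (v : Fin 5 → ℝ) :
    (g⁻¹).1.1.mulVec (g.1.1.mulVec v) = v := inv_smul_smul g.1 v

theorem mulVec_inv_mulVec (g : SO32) (v : Fin 5 → ℝ) :
    g.1.1.mulVec ((g⁻¹).1.1.mulVec v) = v := smul_inv_smul g.1 v

theorem mul_mulVec (g h : SO32) (v : Fin 5 → ℝ) :
    (g * h).1.1.mulVec v = g.1.1.mulVec (h.1.1.mulVec v) := mul_smul g.1 h.1 v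

theorem ip_mulVec_left (g : SO32) (u v : Fin 5 → ℝ) :
    ip u (g.1.1.mulVec v) = ip ((g⁻¹).1.1.mulVec u) v := by
  rw [← ip_mulVec g⁻¹, inv_mulVec_mulVec]

/-- The normals of the three hyperplanes that contain the stem and the two wings: the spacelike
direction of the spine and the two null directions of `p₁` and `p₂`. -/
def wallNormal : Fin 3 → Fin 5 → ℝ := ![![1, 0, 0, 0, 0], ![0, -1, 1, 0, 0], ![0, 1, 1, 0, 0]]

theorem exists_ip_wallNormal_eq_zero {v : Fin 5 → ℝ} (hv : v ∈ crookedCone) :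
    ∃ i, ip (wallNormal i) v = 0 := by
  rcases hv with ⟨h, -⟩ | ⟨h, -⟩ | ⟨h, -⟩
  · exact ⟨1, by simp [wallNormal, ip]; linarith⟩
  · exact ⟨0, by simp [wallNormal, ip]; linarith⟩
  · exact ⟨2, by simp [wallNormal, ip]; linarith⟩

/-- If finitely many cubic polynomials cover the positive reals by their zeros, one of them is zero.
Hence a cubic curve covered by finitely many hyperplanes lies in one of them. -/
theorem exists_cubic_eq_zero {ι : Type*} [Fintype ι] (a b c d : ι → ℝ)
    (h : ∀ t > 0, ∃ i, a i + b i * t + c i * t ^ 2 + d i * t ^ 3 = 0) :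
    ∃ i, a i = 0 ∧ b i = 0 ∧ c i = 0 ∧ d i = 0 := by
  classical
  let p : ι → Polynomial ℝ := fun i => Polynomial.C (a i) + Polynomial.C (b i) * Polynomial.X +
    Polynomial.C (c i) * Polynomial.X ^ 2 + Polynomial.C (d i) * Polynomial.X ^ 3
  have hp : ∏ i, p i = 0 := by
    refine Polynomial.eq_zero_of_infinite_isRoot _ ((Set.Ioi_infinite (0 : ℝ)).mono fun t ht => ?_)
    obtain ⟨i, hi⟩ := h t ht
    rw [Set.mem_ofPred_eq, Polynomial.IsRoot, Polynomial.eval_prod]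
    exact Finset.prod_eq_zero (Finset.mem_univ i) (by simpa [p] using hi)
  obtain ⟨i, -, hi⟩ := Finset.prod_eq_zero_iff.1 hp
  have hc : ∀ k, (p i).coeff k = 0 := fun k => by rw [hi, Polynomial.coeff_zero]
  simp only [p, Polynomial.coeff_add, Polynomial.coeff_C_mul, Polynomial.coeff_C,
    Polynomial.coeff_X, Polynomial.coeff_X_pow] at hc
  exact ⟨i, by simpa using hc 0, by simpa using hc 1, by simpa using hc 2, by simpa using hc 3⟩

/-- A cubic curve of null vectors in the cone lies in the preimage under `g` of one of the three
walls. The functions `k₀, k₁, k₂, k₃` are the coefficients of the restriction to the curve of the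
linear form `ip m`, and `m` is the normal of the preimage of the wall. -/
theorem exists_wall_of_curve {g : SO32} (hg : g ∈ MulAction.stabilizer SO32 crookedSurface)
    (c : ℝ → Fin 5 → ℝ) (h4 : ∀ t, c t 4 = 1) (hn : ∀ t, ip (c t) (c t) = 0)
    (hc : ∀ t > 0, c t ∈ crookedCone) {k₀ k₁ k₂ k₃ : (Fin 5 → ℝ) → ℝ}
    (hk : ∀ m t, ip m (c t) = k₀ m + k₁ m * t + k₂ m * t ^ 2 + k₃ m * t ^ 3) :
    ∃ i m, (g⁻¹).1.1.mulVec (wallNormal i) = m ∧ k₀ m = 0 ∧ k₁ m = 0 ∧ k₂ m = 0 ∧ k₃ m = 0 := by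
  suffices h : ∃ i, k₀ ((g⁻¹).1.1.mulVec (wallNormal i)) = 0 ∧
      k₁ ((g⁻¹).1.1.mulVec (wallNormal i)) = 0 ∧ k₂ ((g⁻¹).1.1.mulVec (wallNormal i)) = 0 ∧
      k₃ ((g⁻¹).1.1.mulVec (wallNormal i)) = 0 from h.imp fun i hi => ⟨_, rfl, hi⟩
  refine exists_cubic_eq_zero (fun i => k₀ ((g⁻¹).1.1.mulVec (wallNormal i)))
    (fun i => k₁ ((g⁻¹).1.1.mulVec (wallNormal i))) (fun i => k₂ ((g⁻¹).1.1.mulVec (wallNormal i)))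
    (fun i => k₃ ((g⁻¹).1.1.mulVec (wallNormal i))) fun t ht => ?_
  have h0 : c t ≠ 0 := fun h => by simpa [h] using h4 t
  obtain ⟨i, hi⟩ :=
    exists_ip_wallNormal_eq_zero ((mem_crookedCone_smul_iff hg h0 (hn t)).2 (hc t ht))
  exact ⟨i, by rw [← hk, ← ip_mulVec_left, hi]⟩

theorem inv_mulVec_eq_smul {g : SO32} {u v : Fin 5 → ℝ} {c : ℝ} (hv : v ≠ 0)
    (h : (g⁻¹).1.1.mulVec v = c • u) : c⁻¹ • v = g.1.1.mulVec u := by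
  have h1 : v = c • g.1.1.mulVec u := by
    rw [← Matrix.mulVec_smul, ← h, mulVec_inv_mulVec]
  have hc : c ≠ 0 := by rintro rfl; exact hv (by rw [h1, zero_smul])
  rw [h1, smul_smul, inv_mul_cancel₀ hc, one_smul]

theorem wallNormal_ne_zero (i : Fin 3) : wallNormal i ≠ 0 := by
  intro h
  fin_cases i
  · simpa [wallNormal] using congrFun h 0
  · simpa [wallNormal] using congrFun h 1
  · simpa [wallNormal] using congrFun h 1

/-- Elements of the stabilizer permute the lines spanned by the wall normals. -/
theorem exists_mulVec_wallNormal {g : SO32}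
    (hg : g ∈ MulAction.stabilizer SO32 crookedSurface) (j : Fin 3) :
    ∃ (i : Fin 3) (c : ℝ), g.1.1.mulVec (wallNormal j) = c • wallNormal i := by
  suffices h : ∃ (i : Fin 3) (c : ℝ), (g⁻¹).1.1.mulVec (wallNormal i) = c • wallNormal j by
    obtain ⟨i, c, h⟩ := h
    exact ⟨i, c⁻¹, (inv_mulVec_eq_smul (wallNormal_ne_zero i) h).symm⟩
  -- for each wall, a cubic curve in its piece of the cone whose coefficients span the wall
  fin_cases j
  · obtain ⟨i, m, hm, h0, h1, h2, h3⟩ := exists_wall_of_curve hg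
      (fun t => ![0, (t - t ^ 2) / 2, (t + t ^ 2) / 2, -t ^ 3, 1]) (fun t => rfl)
      (fun t => by simp [ip]; ring)
      (fun t ht => Or.inr (Or.inl ⟨rfl, by simp; have : 0 < t := ht; positivity⟩))
      (k₀ := fun m => -(1 / 2) * m 3) (k₁ := fun m => (m 1 - m 2) / 2)
      (k₂ := fun m => -(m 1 + m 2) / 2) (k₃ := fun m => m 4 / 2)
      (fun m t => by simp [ip]; ring)
    refine ⟨i, m 0, hm.trans ?_⟩
    ext k
    fin_cases k <;> simp [wallNormal] <;> linarith
  · obtain ⟨i, m, hm, h0, h1, h2, h3⟩ := exists_wall_of_curve hg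
      (fun t => ![t, t ^ 3, -t ^ 3, t ^ 2, 1]) (fun t => rfl)
      (fun t => by simp [ip]; ring)
      (fun t ht => Or.inl ⟨by simp, by simp; have : 0 < t := ht; positivity, by simpa using ht.le⟩)
      (k₀ := fun m => -(1 / 2) * m 3) (k₁ := fun m => m 0)
      (k₂ := fun m => -(1 / 2) * m 4) (k₃ := fun m => m 1 + m 2)
      (fun m t => by simp [ip]; ring)
    refine ⟨i, m 2, hm.trans ?_⟩
    ext k
    fin_cases k <;> simp [wallNormal] <;> linarith
  · obtain ⟨i, m, hm, h0, h1, h2, h3⟩ := exists_wall_of_curve hg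
      (fun t => ![-t, t ^ 3, t ^ 3, t ^ 2, 1]) (fun t => rfl)
      (fun t => by simp [ip]; ring)
      (fun t ht => Or.inr (Or.inr ⟨rfl, by
        simp only [Matrix.cons_val]; have : 0 < t := ht; nlinarith [pow_pos this 3],
        by simpa using ht.le⟩))
      (k₀ := fun m => -(1 / 2) * m 3) (k₁ := fun m => - m 0)
      (k₂ := fun m => -(1 / 2) * m 4) (k₃ := fun m => m 1 - m 2)
      (fun m t => by simp [ip]; ring)
    refine ⟨i, m 2, hm.trans ?_⟩
    ext k
    fin_cases k <;> simp [wallNormal] <;> linarith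

/-! ### Isometries that are diagonal in the eigenbasis of the Cartan subgroup -/

/-- The common eigenvectors of the Cartan subgroup: the wall normals, followed by the null vectors
of `pInf` and `p₀`. -/
def cartanBasis : Fin 5 → Fin 5 → ℝ :=
  ![![1, 0, 0, 0, 0], ![0, -1, 1, 0, 0], ![0, 1, 1, 0, 0], ![0, 0, 0, 1, 0], ![0, 0, 0, 0, 1]]

/-- The matrix whose columns are the vectors of `cartanBasis`. -/
def cartanFrame : Matrix (Fin 5) (Fin 5) ℝ := (Matrix.of cartanBasis).transpose

theorem det_cartanFrame : cartanFrame.det ≠ 0 := by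
  rw [cartanFrame, Matrix.det_transpose]
  simp [cartanBasis, Matrix.det_succ_row_zero, Fin.sum_univ_succ, Fin.succAbove]

theorem mul_cartanFrame_iff (M : Matrix (Fin 5) (Fin 5) ℝ) (d : Fin 5 → ℝ) :
    M * cartanFrame = cartanFrame * Matrix.diagonal d ↔
      ∀ i, M.mulVec (cartanBasis i) = d i • cartanBasis i := by
  rw [← Matrix.ext_iff, forall_comm]
  refine forall_congr' fun j => ?_
  rw [funext_iff]
  refine forall_congr' fun i => ?_
  rw [Matrix.mul_diagonal, mul_comm _ (d j)]
  rfl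

theorem cartanHom_mulVec_cartanBasis (r q : PosReal) (i : Fin 5) :
    (cartanHom (r, q)).1.1.mulVec (cartanBasis i) =
      (![1, (q : ℝ)⁻¹, q, r, (r : ℝ)⁻¹] : Fin 5 → ℝ) i • cartanBasis i := by
  rw [cartanHom_mulVec]
  ext j
  fin_cases i <;> fin_cases j <;> simp [cartanBasis] <;> ring

/-- Constraints on the eigenvalues of an isometry of determinant `1` that is diagonal
in `cartanBasis`. -/
theorem eigenvalue_relations {g : SO32} {d : Fin 5 → ℝ}
    (h : ∀ i, g.1.1.mulVec (cartanBasis i) = d i • cartanBasis i) :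
    d 0 = 1 ∧ d 1 * d 2 = 1 ∧ d 3 * d 4 = 1 := by
  have h12 := ip_mulVec g (cartanBasis 1) (cartanBasis 2)
  have h34 := ip_mulVec g (cartanBasis 3) (cartanBasis 4)
  rw [h, h] at h12 h34
  simp [ip, cartanBasis] at h12 h34
  have e12 : d 1 * d 2 = 1 := by linarith
  have e34 : d 3 * d 4 = 1 := by linarith
  refine ⟨?_, e12, e34⟩
  have hdet := congrArg Matrix.det ((mul_cartanFrame_iff _ _).2 h)
  rw [Matrix.det_mul, Matrix.det_mul, Matrix.det_diagonal, g.1.2, one_mul,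
    eq_comm, mul_eq_left₀ det_cartanFrame] at hdet
  simp only [Fin.prod_univ_five] at hdet
  have : d 0 * (d 1 * d 2) * (d 3 * d 4) = 1 := by linarith
  simpa [e12, e34] using this

theorem mem_cartanA_of_eigen {g : SO32} {d : Fin 5 → ℝ}
    (h : ∀ i, g.1.1.mulVec (cartanBasis i) = d i • cartanBasis i) (h2 : 0 < d 2) (h3 : 0 < d 3) :
    g ∈ cartanA := by
  obtain ⟨e0, e12, e34⟩ := eigenvalue_relations h
  refine ⟨(⟨d 3, h3⟩, ⟨d 2, h2⟩), ?_⟩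
  have hd : (![1, (d 2)⁻¹, d 2, d 3, (d 3)⁻¹] : Fin 5 → ℝ) = d := by
    ext i
    fin_cases i
    · exact e0.symm
    · exact (eq_inv_of_mul_eq_one_left e12).symm
    · rfl
    · rfl
    · exact (eq_inv_of_mul_eq_one_right e34).symm
  have h1 := (mul_cartanFrame_iff _ _).2 (cartanHom_mulVec_cartanBasis ⟨d 3, h3⟩ ⟨d 2, h2⟩)
  rw [hd, ← (mul_cartanFrame_iff _ _).2 h] at h1
  exact Subtype.ext (Subtype.ext
    ((Matrix.isUnit_iff_isUnit_det _).2 (Ne.isUnit det_cartanFrame) |>.mul_right_cancel h1))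

/-- `A` contains an element with simple spectrum, so a simultaneously diagonalizable group that
contains `A` is diagonal in `cartanBasis`. -/
theorem isCartanSubgroup_cartanA : IsCartanSubgroup cartanA := by
  constructor
  · refine ⟨Matrix.GeneralLinearGroup.mkOfDetNeZero cartanFrame det_cartanFrame, ?_⟩
    rintro _ ⟨⟨r, q⟩, rfl⟩
    have hr := r.2
    have hq := q.2
    refine ⟨_, ?_, (mul_cartanFrame_iff _ _).2 (cartanHom_mulVec_cartanBasis r q)⟩
    intro i
    fin_cases i <;> simp [hr, hq]
  · rintro B ⟨P, hP⟩ hAB g hg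
    let a : SO32 := cartanHom (⟨2, by norm_num⟩, ⟨3, by norm_num⟩)
    have ha : a ∈ B := hAB ⟨_, rfl⟩
    obtain ⟨d, hd, hgP⟩ := hP g hg
    obtain ⟨d', -, haP⟩ := hP a ha
    have hcomm : g.1.1 * a.1.1 = a.1.1 * g.1.1 := by
      refine P.isUnit.mul_right_cancel ?_
      rw [mul_assoc, haP, ← mul_assoc, hgP, mul_assoc, mul_assoc, hgP, ← mul_assoc a.1.1, haP,
        mul_assoc, Matrix.diagonal_mul_diagonal, Matrix.diagonal_mul_diagonal]
      simp_rw [mul_comm]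
    let F := Matrix.GeneralLinearGroup.mkOfDetNeZero cartanFrame det_cartanFrame
    let m : Fin 5 → ℝ := ![1, (3 : ℝ)⁻¹, 3, 2, (2 : ℝ)⁻¹]
    have haF : a.1.1 * F.1 = F.1 * Matrix.diagonal m :=
      (mul_cartanFrame_iff _ _).2 (cartanHom_mulVec_cartanBasis _ _)
    -- in the eigenbasis, `g` commutes with a diagonal matrix with distinct entries
    let G := F⁻¹.1 * g.1.1 * F.1
    have hG : g.1.1 * F.1 = F.1 * G := by
      simp only [G, ← mul_assoc, Units.mul_inv, one_mul]
    have hGm : G * Matrix.diagonal m = Matrix.diagonal m * G := by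
      refine F.isUnit.mul_left_cancel ?_
      rw [← mul_assoc, ← hG, mul_assoc, ← haF, ← mul_assoc, hcomm, mul_assoc, hG, ← mul_assoc, haF,
        mul_assoc]
    have hGd : G = Matrix.diagonal G.diag := by
      ext i j
      by_cases hij : i = j
      · subst hij; simp
      · rw [Matrix.diagonal_apply_ne _ hij]
        have h1 := congrFun (congrFun hGm i) j
        rw [Matrix.mul_diagonal, Matrix.diagonal_mul] at h1
        have h2 : m j - m i ≠ 0 := by
          fin_cases i <;> fin_cases j <;> simp [m] at hij ⊢ <;> norm_num
        have h3 : G i j * (m j - m i) = 0 := by linarith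
        exact (mul_eq_zero.1 h3).resolve_right h2
    have hb := (mul_cartanFrame_iff _ _).1 (show g.1.1 * cartanFrame = _ by rw [← hGd]; exact hG)
    have hpos : ∀ i, 0 < G.diag i := by
      intro i
      have hy : P⁻¹.1.mulVec (cartanBasis i) ≠ 0 := by
        intro h0
        have : P.1.mulVec (P⁻¹.1.mulVec (cartanBasis i)) = cartanBasis i := by
          rw [Matrix.mulVec_mulVec, Units.mul_inv, Matrix.one_mulVec]
        rw [h0, Matrix.mulVec_zero] at this
        fin_cases i
        · simpa [cartanBasis] using congrFun this 0
        · simpa [cartanBasis] using congrFun this 2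
        · simpa [cartanBasis] using congrFun this 2
        · simpa [cartanBasis] using congrFun this 3
        · simpa [cartanBasis] using congrFun this 4
      obtain ⟨j, hj⟩ := Function.ne_iff.1 hy
      have h1 : P⁻¹.1 * g.1.1 = Matrix.diagonal d * P⁻¹.1 := by
        refine P.isUnit.mul_right_cancel ?_
        rw [mul_assoc, hgP, ← mul_assoc, Units.inv_mul, mul_assoc, Units.inv_mul, one_mul, mul_one]
      have h2 := congrArg (fun M => M.mulVec (cartanBasis i) j) h1
      simp only [← Matrix.mulVec_mulVec, hb, Matrix.mulVec_smul, Matrix.mulVec_diagonal] at h2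
      rw [Pi.smul_apply, smul_eq_mul] at h2
      rw [mul_right_cancel₀ hj h2]
      exact hd j
    exact mem_cartanA_of_eigen hb (hpos 2) (hpos 3)

/-! ### The stabilizer is generated by `A` and the involutions -/

/-- The group generated by `A` and the three involutions. -/
def crookedGroup : Subgroup SO32 := Subgroup.closure ((cartanA : Set SO32) ∪ {s₀, s₁, s₂})

theorem s₀_mem : s₀ ∈ crookedGroup := Subgroup.subset_closure (by simp)

theorem s₁_mem : s₁ ∈ crookedGroup := Subgroup.subset_closure (by simp)

theorem s₂_mem : s₂ ∈ crookedGroup := Subgroup.subset_closure (by simp)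

theorem cartanA_le : cartanA ≤ crookedGroup :=
  fun _ h => Subgroup.subset_closure (Or.inl h)

theorem crookedGroup_le : crookedGroup ≤ MulAction.stabilizer SO32 crookedSurface := by
  rw [crookedGroup, Subgroup.closure_le]
  rintro g (⟨a, rfl⟩ | rfl | rfl | rfl)
  · exact cartanHom_mem_stabilizer a
  · exact s₀_mem_stabilizer
  · exact s₁_mem_stabilizer
  · exact s₂_mem_stabilizer

/-- An element of the stabilizer that is diagonal in `cartanBasis` with positive eigenvalue on `p₂`
lies in `A`: its determinant forces the eigenvalue `1` on the spine, and then negative eigenvalues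
on `p₀` and `pInf` would move the wing point `[1 : 1 : -1 : 1 : 1]` off the surface. -/
theorem mem_cartanA_of_diagonal {g : SO32} (hg : g ∈ MulAction.stabilizer SO32 crookedSurface)
    {d : Fin 5 → ℝ} (h : ∀ i, g.1.1.mulVec (cartanBasis i) = d i • cartanBasis i)
    (h2 : 0 < d 2) : g ∈ cartanA := by
  refine mem_cartanA_of_eigen h h2 ?_
  obtain ⟨e0, e12, e34⟩ := eigenvalue_relations h
  have h1 : 0 < d 1 := pos_of_mul_pos_left (by rw [e12]; norm_num) h2.le
  have hv : (![1, 1, -1, 1, 1] : Fin 5 → ℝ) =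
      cartanBasis 0 - cartanBasis 1 + cartanBasis 3 + cartanBasis 4 := by
    ext i; fin_cases i <;> simp [cartanBasis]
  have hw : g.1.1.mulVec ![1, 1, -1, 1, 1] = ![1, d 1, -d 1, d 3, d 4] := by
    rw [hv, Matrix.mulVec_add, Matrix.mulVec_add, Matrix.mulVec_sub, h, h, h, h, e0]
    ext i; fin_cases i <;> simp [cartanBasis]
  have hm := (mem_crookedCone_smul_iff hg (v := ![1, 1, -1, 1, 1])
    (fun h => by simpa using congrFun h 0) (by simp [ip]; norm_num)).2 (Or.inl (by simp))
  rw [hw] at hm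
  have h3 : d 3 ≠ 0 := left_ne_zero_of_mul (by rw [e34]; exact one_ne_zero)
  simp [crookedCone] at hm
  rcases hm with hm | hm
  · exact lt_of_le_of_ne hm.1 h3.symm
  · linarith [hm.1]

/-- The sign of the eigenvalues on `p₁` and `p₂` is adjusted by `s₀`. -/
theorem mem_crookedGroup_of_diagonal {g : SO32}
    (hg : g ∈ MulAction.stabilizer SO32 crookedSurface)
    {d : Fin 5 → ℝ} (h : ∀ i, g.1.1.mulVec (cartanBasis i) = d i • cartanBasis i) :
    g ∈ crookedGroup := by
  obtain ⟨e0, e12, e34⟩ := eigenvalue_relations h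
  have h2 : d 2 ≠ 0 := right_ne_zero_of_mul (by rw [e12]; exact one_ne_zero)
  rcases h2.lt_or_gt with h2 | h2
  · refine (Subgroup.mul_mem_cancel_left _ s₀_mem).1 (cartanA_le (mem_cartanA_of_diagonal
      (Subgroup.mul_mem _ s₀_mem_stabilizer hg) (d := ![d 0, -d 1, -d 2, d 3, d 4]) ?_ ?_))
    · intro i
      rw [mul_mulVec, h, s₀_mulVec]
      ext j
      fin_cases i <;> fin_cases j <;> simp [cartanBasis]
    · simpa using h2
  · exact cartanA_le (mem_cartanA_of_diagonal hg h h2)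

/-- An isometry that preserves each wall preserves their intersection, a Lorentzian plane, whose two
null lines it fixes or exchanges; `s₁` reduces the second case to the first. -/
theorem mem_crookedGroup_of_walls {g : SO32}
    (hg : g ∈ MulAction.stabilizer SO32 crookedSurface) {c : Fin 3 → ℝ}
    (h : ∀ i, g.1.1.mulVec (wallNormal i) = c i • wallNormal i) : g ∈ crookedGroup := by
  have hc : ∀ i, c i ≠ 0 := by
    intro i h0
    have h1 := h i
    rw [h0, zero_smul] at h1
    refine wallNormal_ne_zero i ?_
    rw [← inv_mulVec_mulVec g (wallNormal i), h1, Matrix.mulVec_zero]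
  have horth : ∀ v, (∀ i, ip (wallNormal i) v = 0) →
      g.1.1.mulVec v = ![0, 0, 0, g.1.1.mulVec v 3, g.1.1.mulVec v 4] := by
    intro v hv
    have key : ∀ i, ip (wallNormal i) (g.1.1.mulVec v) = 0 := by
      intro i
      have h1 := ip_mulVec g (wallNormal i) v
      rw [h, hv] at h1
      have h2 : c i * ip (wallNormal i) (g.1.1.mulVec v) = 0 := by
        rw [← h1]; simp only [ip, Pi.smul_apply, smul_eq_mul]; ring
      exact (mul_eq_zero.1 h2).resolve_left (hc i)
    generalize g.1.1.mulVec v = w at key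
    have k0 := key 0
    have k1 := key 1
    have k2 := key 2
    simp [ip, wallNormal] at k0 k1 k2
    ext i
    fin_cases i <;> simp <;> linarith
  have h3 := horth (cartanBasis 3) (fun i => by fin_cases i <;> simp [wallNormal, cartanBasis, ip])
  have h4 := horth (cartanBasis 4) (fun i => by fin_cases i <;> simp [wallNormal, cartanBasis, ip])
  have i33 := ip_mulVec g (cartanBasis 3) (cartanBasis 3)
  have i44 := ip_mulVec g (cartanBasis 4) (cartanBasis 4)
  have i34 := ip_mulVec g (cartanBasis 3) (cartanBasis 4)
  generalize g.1.1.mulVec (cartanBasis 3) 3 = x at h3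
  generalize g.1.1.mulVec (cartanBasis 3) 4 = y at h3
  generalize g.1.1.mulVec (cartanBasis 4) 3 = z at h4
  generalize g.1.1.mulVec (cartanBasis 4) 4 = t at h4
  rw [h3] at i33 i34
  rw [h4] at i44 i34
  simp [ip, cartanBasis] at i33 i44 i34
  have hxy : x * y = 0 := by linarith
  have hzt : z * t = 0 := by linarith
  have h0 := h 0
  have h1 := h 1
  have h2 := h 2
  change g.1.1.mulVec (cartanBasis 0) = c 0 • cartanBasis 0 at h0
  change g.1.1.mulVec (cartanBasis 1) = c 1 • cartanBasis 1 at h1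
  change g.1.1.mulVec (cartanBasis 2) = c 2 • cartanBasis 2 at h2
  by_cases hy : y = 0
  · have hz : z = 0 := by
      refine (mul_eq_zero.1 hzt).resolve_right fun ht => ?_
      norm_num [hy, ht] at i34
    refine mem_crookedGroup_of_diagonal hg (d := ![c 0, c 1, c 2, x, t]) fun i => ?_
    fin_cases i
    · exact h0
    · exact h1
    · exact h2
    · refine h3.trans ?_
      ext j; fin_cases j <;> simp [cartanBasis, hy]
    · refine h4.trans ?_
      ext j; fin_cases j <;> simp [cartanBasis, hz]
  · have hx : x = 0 := (mul_eq_zero.1 hxy).resolve_right hy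
    have ht : t = 0 := by
      refine (mul_eq_zero.1 hzt).resolve_left fun hz => ?_
      norm_num [hx, hz] at i34
    refine (Subgroup.mul_mem_cancel_left _ s₁_mem).1 (mem_crookedGroup_of_diagonal
      (Subgroup.mul_mem _ s₁_mem_stabilizer hg) (d := ![-c 0, -c 1, -c 2, -y, -z]) fun i => ?_)
    rw [mul_mulVec, s₁_mulVec]
    fin_cases i
    · simp only [Fin.zero_eta, h0]
      ext j; fin_cases j <;> simp [cartanBasis]
    · simp only [Fin.mk_one, h1]
      ext j; fin_cases j <;> simp [cartanBasis]
    · simp only [Fin.reduceFinMk, h2]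
      ext j; fin_cases j <;> simp [cartanBasis]
    · simp only [Fin.reduceFinMk, h3]
      ext j; fin_cases j <;> simp [cartanBasis, hx]
    · simp only [Fin.reduceFinMk, h4]
      ext j; fin_cases j <;> simp [cartanBasis, ht]

theorem stabilizer_eq_crookedGroup :
    MulAction.stabilizer SO32 crookedSurface = crookedGroup := by
  refine le_antisymm (fun g hg => ?_) crookedGroup_le
  obtain ⟨i, a, h0⟩ := exists_mulVec_wallNormal hg 0
  obtain ⟨j, b, h1⟩ := exists_mulVec_wallNormal hg 1
  obtain ⟨k, c, h2⟩ := exists_mulVec_wallNormal hg 2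
  have i00 := ip_mulVec g (wallNormal 0) (wallNormal 0)
  have i11 := ip_mulVec g (wallNormal 1) (wallNormal 1)
  have i22 := ip_mulVec g (wallNormal 2) (wallNormal 2)
  have i12 := ip_mulVec g (wallNormal 1) (wallNormal 2)
  rw [h0] at i00
  rw [h1] at i11 i12
  rw [h2] at i22 i12
  -- only the first normal is spacelike, and the other two are not orthogonal
  have hi : i = 0 := by
    fin_cases i <;> simp [ip, wallNormal] at i00 ⊢
  have hjk : (j = 1 ∧ k = 2) ∨ (j = 2 ∧ k = 1) := by
    fin_cases j <;> fin_cases k <;> simp [ip, wallNormal] at i11 i22 i12 ⊢ <;>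
      norm_num [i11] at i12
  subst hi
  rcases hjk with ⟨rfl, rfl⟩ | ⟨rfl, rfl⟩
  · refine mem_crookedGroup_of_walls hg (c := ![a, b, c]) fun i => ?_
    fin_cases i
    · exact h0
    · exact h1
    · exact h2
  · refine (Subgroup.mul_mem_cancel_left _ s₂_mem).1 (mem_crookedGroup_of_walls
      (Subgroup.mul_mem _ s₂_mem_stabilizer hg) (c := ![-a, -b, -c]) fun i => ?_)
    rw [mul_mulVec, s₂_mulVec]
    fin_cases i
    · simp only [Fin.zero_eta, h0]
      ext j; fin_cases j <;> simp [wallNormal]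
    · simp only [Fin.mk_one, h1]
      ext j; fin_cases j <;> simp [wallNormal]
    · simp only [Fin.reduceFinMk, h2]
      ext j; fin_cases j <;> simp [wallNormal]

/-! ### Relations among the generators -/

theorem SO32_ext {g h : SO32} (H : ∀ v, g.1.1.mulVec v = h.1.1.mulVec v) : g = h :=
  Subtype.ext (Subtype.ext (Matrix.ext_of_mulVec_single fun _ => H _))

theorem one_mulVec (v : Fin 5 → ℝ) : (1 : SO32).1.1.mulVec v = v :=
  Matrix.one_mulVec v

theorem involution_mul_self (i : Fin 3) : ![s₀, s₁, s₂] i * ![s₀, s₁, s₂] i = 1 := by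
  refine SO32_ext fun v => ?_
  rw [one_mulVec, mul_mulVec]
  ext j
  fin_cases i <;> simp [s₀_mulVec, s₁_mulVec, s₂_mulVec] <;> fin_cases j <;> rfl

theorem involution_commute (i j : Fin 3) : Commute (![s₀, s₁, s₂] i) (![s₀, s₁, s₂] j) := by
  refine SO32_ext fun v => ?_
  rw [mul_mulVec, mul_mulVec]
  fin_cases i <;> fin_cases j <;> simp [s₀_mulVec, s₁_mulVec, s₂_mulVec]

theorem orderOf_involution (i : Fin 3) : orderOf (![s₀, s₁, s₂] i) = 2 := by
  refine orderOf_eq_prime (by rw [sq, involution_mul_self]) fun h => ?_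
  have h1 := congrArg (fun g : SO32 => g.1.1.mulVec ![0, 0, 1, 0, 0] 2) h
  simp only [one_mulVec] at h1
  fin_cases i <;> simp [s₀_mulVec, s₁_mulVec, s₂_mulVec] at h1 <;> linarith

/-- The automorphisms of `A` induced by conjugation by the involutions: `s₁` inverts the homothety
ratio and `s₂` inverts the hyperbolic eigenvalue. -/
noncomputable def involutionAut : Fin 3 → MulAut (PosReal × PosReal) :=
  ![1, (MulEquiv.inv PosReal).prodCongr (MulEquiv.refl _),
    (MulEquiv.refl _).prodCongr (MulEquiv.inv PosReal)]

theorem involutionAut_mul_self (i : Fin 3) : involutionAut i * involutionAut i = 1 := by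
  refine MulEquiv.ext fun a => ?_
  fin_cases i
  · rfl
  · exact Prod.ext (inv_inv a.1) rfl
  · exact Prod.ext rfl (inv_inv a.2)

theorem involutionAut_commute (i j : Fin 3) : Commute (involutionAut i) (involutionAut j) := by
  refine MulEquiv.ext fun a => ?_
  fin_cases i <;> fin_cases j <;> rfl

theorem cartanHom_involutionAut_mul (i : Fin 3) (a : PosReal × PosReal) :
    cartanHom (involutionAut i a) * ![s₀, s₁, s₂] i = ![s₀, s₁, s₂] i * cartanHom a := by
  obtain ⟨r, q⟩ := a
  refine SO32_ext fun v => ?_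
  rw [mul_mulVec, mul_mulVec]
  fin_cases i <;>
    simp [involutionAut, MulEquiv.prodCongr, s₀_mulVec, s₁_mulVec, s₂_mulVec, cartanHom_mulVec] <;>
    constructor <;> ring

/-! ### The semidirect product -/

/-- The homomorphism from `ℤ₂` given by an element of square `1`. -/
def z2Lift {G : Type*} [Group G] (t : G) (ht : t * t = 1) : Multiplicative (ZMod 2) →* G where
  toFun x := t ^ x.toAdd.val
  map_one' := pow_zero t
  map_mul' := by
    have key : ∀ x y : ZMod 2, t ^ (x + y).val = t ^ x.val * t ^ y.val := by
      intro x y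
      fin_cases x <;> fin_cases y
      · change t ^ 0 = t ^ 0 * t ^ 0
        simp
      · change t ^ 1 = t ^ 0 * t ^ 1
        simp
      · change t ^ 1 = t ^ 1 * t ^ 0
        simp
      · change t ^ 0 = t ^ 1 * t ^ 1
        rw [pow_zero, pow_one, ht]
    exact fun x y => key x.toAdd y.toAdd

theorem pairwise_commute_z2Lift {G : Type*} [Group G] (t : Fin 3 → G) (ht : ∀ i, t i * t i = 1)
    (hc : ∀ i j, Commute (t i) (t j)) : Pairwise fun i j => ∀ x y : Multiplicative (ZMod 2),
      Commute (z2Lift (t i) (ht i) x) (z2Lift (t j) (ht j) y) :=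
  fun i j _ _ _ => (hc i j).pow_pow _ _

/-- The homomorphism from `ℤ₂³` given by three commuting elements of square `1`. -/
def z2CubedLift {G : Type*} [Group G] (t : Fin 3 → G) (ht : ∀ i, t i * t i = 1)
    (hc : ∀ i j, Commute (t i) (t j)) : Z2Cubed →* G :=
  MonoidHom.noncommPiCoprod (fun i => z2Lift (t i) (ht i)) (pairwise_commute_z2Lift t ht hc)

theorem z2CubedLift_z2gen {G : Type*} [Group G] (t : Fin 3 → G) (ht : ∀ i, t i * t i = 1)
    (hc : ∀ i j, Commute (t i) (t j)) (i : Fin 3) : z2CubedLift t ht hc (z2gen i) = t i := by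
  rw [z2gen, z2CubedLift, MonoidHom.noncommPiCoprod_mulSingle]
  exact pow_one _

theorem z2Cubed_induction {p : Z2Cubed → Prop} (one : p 1) (mul : ∀ x y, p x → p y → p (x * y))
    (gen : ∀ i, p (z2gen i)) (z : Z2Cubed) : p z := by
  refine Pi.mulSingle_induction p z one mul fun i m => ?_
  obtain rfl | rfl : m = 1 ∨ m = Multiplicative.ofAdd 1 := by
    revert m
    decide
  · rwa [Pi.mulSingle_one]
  · exact gen i

theorem z2Cubed_eq_prod (z : Z2Cubed) : ∃ a b c : Fin 2,
    z = z2gen 0 ^ (a : ℕ) * z2gen 1 ^ (b : ℕ) * z2gen 2 ^ (c : ℕ) := by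
  revert z
  decide

/-- The action of `ℤ₂³` on `A` by conjugation. -/
noncomputable def z2Action : Z2Cubed →* MulAut (PosReal × PosReal) :=
  z2CubedLift involutionAut involutionAut_mul_self involutionAut_commute

/-- The embedding of `ℤ₂³` in `SO(3,2)` as the group generated by the involutions. -/
noncomputable def z2Hom : Z2Cubed →* SO32 :=
  z2CubedLift ![s₀, s₁, s₂] involution_mul_self involution_commute

theorem z2Hom_z2gen (i : Fin 3) : z2Hom (z2gen i) = ![s₀, s₁, s₂] i := z2CubedLift_z2gen ..

theorem cartanHom_z2Action_mul (z : Z2Cubed) (a : PosReal × PosReal) :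
    cartanHom (z2Action z a) * z2Hom z = z2Hom z * cartanHom a := by
  induction z using z2Cubed_induction generalizing a with
  | one => simp
  | mul x y hx hy =>
    rw [map_mul, map_mul, MulAut.mul_apply, ← mul_assoc, hx, mul_assoc, hy, mul_assoc]
  | gen i =>
    rw [z2Hom_z2gen, z2Action, z2CubedLift_z2gen, cartanHom_involutionAut_mul]

/-- The semidirect product of `ℤ₂³` and `(ℝ_{>0})²` maps to `SO(3,2)`. -/
noncomputable def semidirectHom : (PosReal × PosReal) ⋊[z2Action] Z2Cubed →* SO32 :=
  SemidirectProduct.lift cartanHom z2Hom fun z => MonoidHom.ext fun a =>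
    eq_mul_inv_of_mul_eq (cartanHom_z2Action_mul z a)

theorem semidirectHom_inl (a : PosReal × PosReal) :
    semidirectHom (SemidirectProduct.inl a) = cartanHom a :=
  SemidirectProduct.lift_inl ..

theorem semidirectHom_inr (z : Z2Cubed) : semidirectHom (SemidirectProduct.inr z) = z2Hom z :=
  SemidirectProduct.lift_inr ..

theorem range_semidirectHom :
    semidirectHom.range = MulAction.stabilizer SO32 crookedSurface := by
  rw [stabilizer_eq_crookedGroup]
  apply le_antisymm
  · rintro _ ⟨⟨a, z⟩, rfl⟩
    refine Subgroup.mul_mem _ (cartanA_le ⟨a, rfl⟩) ?_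
    change z2Hom z ∈ crookedGroup
    induction z using z2Cubed_induction with
    | one => rw [map_one]; exact one_mem _
    | mul x y hx hy => rw [map_mul]; exact mul_mem hx hy
    | gen i =>
      rw [z2Hom_z2gen]
      fin_cases i
      · exact s₀_mem
      · exact s₁_mem
      · exact s₂_mem
  · have hs (i : Fin 3) : ![s₀, s₁, s₂] i ∈ semidirectHom.range :=
      ⟨SemidirectProduct.inr (z2gen i), (semidirectHom_inr _).trans (z2Hom_z2gen i)⟩
    rw [crookedGroup, Subgroup.closure_le]
    rintro g (⟨a, rfl⟩ | rfl | rfl | rfl)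
    · exact ⟨SemidirectProduct.inl a, semidirectHom_inl a⟩
    · exact hs 0
    · exact hs 1
    · exact hs 2

theorem cartanHom_injective : Function.Injective cartanHom := by
  rintro ⟨r, q⟩ ⟨r', q'⟩ h
  have h2 := congrArg (fun g : SO32 => g.1.1.mulVec (cartanBasis 2) 2) h
  have h3 := congrArg (fun g : SO32 => g.1.1.mulVec (cartanBasis 3) 3) h
  simp only [cartanHom_mulVec_cartanBasis] at h2 h3
  simp [cartanBasis] at h2 h3
  exact Prod.ext (Subtype.ext h3) (Subtype.ext h2)

/-- Elements of `A` act with positive diagonal entries, which distinguishes them from the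
nontrivial products of the involutions. -/
theorem eq_one_of_z2Hom_eq_cartanHom {z : Z2Cubed} {a : PosReal × PosReal}
    (h : z2Hom z = cartanHom a) : z = 1 := by
  obtain ⟨r, q⟩ := a
  have hr := r.2
  have hq : 0 < ((q : ℝ) + (q : ℝ)⁻¹) / 2 := by
    have := q.2
    positivity
  have h1 := congrArg (fun g : SO32 => g.1.1.mulVec ![1, 0, 1, 1, 0]) h
  simp only [cartanHom_mulVec] at h1
  have e0 := congrFun h1 0
  have e2 := congrFun h1 2
  have e3 := congrFun h1 3
  obtain ⟨i, j, k, rfl⟩ := z2Cubed_eq_prod z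
  simp only [map_mul, map_pow, z2Hom_z2gen, mul_mulVec] at e0 e2 e3
  fin_cases i <;> fin_cases j <;> fin_cases k <;>
    simp [s₀_mulVec, s₁_mulVec, s₂_mulVec] at e0 e2 e3 ⊢ <;> linarith

theorem semidirectHom_injective : Function.Injective semidirectHom := by
  rw [injective_iff_map_eq_one]
  rintro ⟨a, z⟩ h
  change cartanHom a * z2Hom z = 1 at h
  have hz : z = 1 := eq_one_of_z2Hom_eq_cartanHom (a := a⁻¹)
    (by rw [map_inv, eq_inv_of_mul_eq_one_right h])
  subst hz
  rw [map_one, mul_one] at h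
  rw [cartanHom_injective (h.trans (map_one _).symm)]
  rfl

/-! ### The normalizer of `A` and the invariant pairs of points -/

theorem crookedGroup_le_normalizer : crookedGroup ≤ Subgroup.normalizer (cartanA : Set SO32) := by
  have hs (i : Fin 3) : ![s₀, s₁, s₂] i ∈ Subgroup.normalizer (cartanA : Set SO32) := by
    have key : ∀ h ∈ cartanA, ![s₀, s₁, s₂] i * h * (![s₀, s₁, s₂] i)⁻¹ ∈ cartanA := by
      rintro _ ⟨a, rfl⟩
      exact ⟨involutionAut i a, eq_mul_inv_of_mul_eq (cartanHom_involutionAut_mul i a)⟩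
    have hinv : (![s₀, s₁, s₂] i)⁻¹ = ![s₀, s₁, s₂] i :=
      inv_eq_of_mul_eq_one_right (involution_mul_self i)
    refine Subgroup.mem_normalizer_iff.2 fun h => ⟨key h, fun hh => ?_⟩
    have := key _ hh
    rwa [hinv, ← mul_assoc, ← mul_assoc, involution_mul_self, one_mul, mul_assoc,
      involution_mul_self, mul_one] at this
  rw [crookedGroup, Subgroup.closure_le]
  rintro g (hg | rfl | rfl | rfl)
  · exact Subgroup.le_normalizer hg
  · exact hs 0
  · exact hs 1
  · exact hs 2

theorem smul_mk_eq_of_mulVec {g : SO32} {v w : Fin 5 → ℝ} {hv hn hw hm} (c : ℝ)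
    (h : c • w = g.1.1.mulVec v) : g • Ein21.mk v hv hn = Ein21.mk w hw hm := by
  rw [smul_mk]
  exact Ein21.mk_eq_mk_of_smul c h

theorem smul_pair_of_fix {g : SO32} {x y : Ein21} (hx : g • x = x) (hy : g • y = y) :
    g • ({x, y} : Set Ein21) = {x, y} := by
  rw [Set.smul_set_insert, Set.smul_set_singleton, hx, hy]

theorem smul_pair_of_swap {g : SO32} {x y : Ein21} (hx : g • x = y) (hy : g • y = x) :
    g • ({x, y} : Set Ein21) = {x, y} := by
  rw [Set.smul_set_insert, Set.smul_set_singleton, hx, hy, Set.pair_comm]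

theorem crookedGroup_le_stabilizer_p₀ :
    crookedGroup ≤ MulAction.stabilizer SO32 ({p₀, pInf} : Set Ein21) := by
  rw [crookedGroup, Subgroup.closure_le]
  rintro g (⟨⟨r, q⟩, rfl⟩ | rfl | rfl | rfl)
  · refine smul_pair_of_fix (smul_mk_eq_of_mulVec (r : ℝ)⁻¹ ?_) (smul_mk_eq_of_mulVec (r : ℝ) ?_) <;>
      rw [cartanHom_mulVec] <;> simp
  · refine smul_pair_of_fix (smul_mk_eq_of_mulVec 1 ?_) (smul_mk_eq_of_mulVec 1 ?_) <;>
      rw [s₀_mulVec] <;> simp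
  · refine smul_pair_of_swap (smul_mk_eq_of_mulVec (-1) ?_) (smul_mk_eq_of_mulVec (-1) ?_) <;>
      rw [s₁_mulVec] <;> simp
  · refine smul_pair_of_fix (smul_mk_eq_of_mulVec 1 ?_) (smul_mk_eq_of_mulVec 1 ?_) <;>
      rw [s₂_mulVec] <;> simp

theorem crookedGroup_le_stabilizer_p₁ :
    crookedGroup ≤ MulAction.stabilizer SO32 ({p₁, p₂} : Set Ein21) := by
  rw [crookedGroup, Subgroup.closure_le]
  rintro g (⟨⟨r, q⟩, rfl⟩ | rfl | rfl | rfl)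
  · exact smul_pair_of_fix
      (smul_mk_eq_of_mulVec (q : ℝ)⁻¹ (cartanHom_mulVec_cartanBasis r q 1).symm)
      (smul_mk_eq_of_mulVec (q : ℝ) (cartanHom_mulVec_cartanBasis r q 2).symm)
  · refine smul_pair_of_fix (smul_mk_eq_of_mulVec (-1) ?_) (smul_mk_eq_of_mulVec (-1) ?_) <;>
      rw [s₀_mulVec] <;> simp
  · refine smul_pair_of_fix (smul_mk_eq_of_mulVec (-1) ?_) (smul_mk_eq_of_mulVec (-1) ?_) <;>
      rw [s₁_mulVec] <;> simp
  · refine smul_pair_of_swap (smul_mk_eq_of_mulVec (-1) ?_) (smul_mk_eq_of_mulVec (-1) ?_) <;>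
      rw [s₂_mulVec] <;> simp

end Crooked

open Crooked
theorem mainTheorem2 :
    -- the elements `s₀, s₁, s₂` are pairwise commuting involutions
    (∀ i : Fin 3, orderOf (![s₀, s₁, s₂] i) = 2) ∧
    (∀ i j : Fin 3, Commute (![s₀, s₁, s₂] i) (![s₀, s₁, s₂] j)) ∧
    -- `A` is a Cartan subgroup
    IsCartanSubgroup cartanA ∧
    -- the stabilizer of the crooked surface is generated by `A` and `s₀, s₁, s₂`
    MulAction.stabilizer SO32 crookedSurface
      = Subgroup.closure ((cartanA : Set SO32) ∪ {s₀, s₁, s₂}) ∧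
    -- it is the semidirect product of `ℤ₂³ = ⟨s₀, s₁, s₂⟩` and `A = (ℝ_{>0})²`
    (∃ (φ : Z2Cubed →* MulAut (PosReal × PosReal))
      (e : ((PosReal × PosReal) ⋊[φ] Z2Cubed) ≃* MulAction.stabilizer SO32 crookedSurface),
      (∀ a : PosReal × PosReal, (e (SemidirectProduct.inl a) : SO32) = cartanHom a) ∧
      (∀ i : Fin 3, (e (SemidirectProduct.inr (z2gen i)) : SO32) = ![s₀, s₁, s₂] i)) ∧
    -- every automorphism normalizes `A` and preserves the two pairs of points
    (∀ g ∈ MulAction.stabilizer SO32 crookedSurface,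
      g ∈ Subgroup.normalizer (cartanA : Set SO32) ∧
      g • ({p₀, pInf} : Set Ein21) = {p₀, pInf} ∧
      g • ({p₁, p₂} : Set Ein21) = {p₁, p₂}) := by
  refine ⟨orderOf_involution, involution_commute, isCartanSubgroup_cartanA,
    stabilizer_eq_crookedGroup, ⟨z2Action,
      (MonoidHom.ofInjective semidirectHom_injective).trans
        (MulEquiv.subgroupCongr range_semidirectHom), fun a => ?_, fun i => ?_⟩, fun g hg => ?_⟩
  · exact semidirectHom_inl a
  · exact (semidirectHom_inr _).trans (z2Hom_z2gen i)
  · rw [stabilizer_eq_crookedGroup] at hg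
    exact ⟨crookedGroup_le_normalizer hg, crookedGroup_le_stabilizer_p₀ hg,
      crookedGroup_le_stabilizer_p₁ hg⟩
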